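/- **(Spectral initialization).** Let $M^\star\in\mathbb{R}^{n\times n}$ be symmetric positive semidefinite of rank $r^\star\ge 1$, let $r\ge r^\star$, write $\lambda_1\ge\lambda_2\ge\cdots$ for eigenvalues in decreasing order and $\kappa=\lambda_1(M^\star)/\lambda_{r^\star}(M^\star)$. Let $A_1,\dots,A_m\in\mathbb{R}^{n\times n}$ be fixed matrices and let $\mathcal{A}(M)=(\langle A_i,M\rangle)_{i=1}^m\in\mathbb{R}^m$ satisfy the restricted isometry property with parameters $(2r,\delta)$: $m\geq 1$, $0\le\delta<1$ and $$(1-\delta)\|M\|_F^2\le \tfrac1m\|\mathcal{A}(M)\|^2\le(1+\delta)\|M\|_F^2\quad\text{for all } M\in\mathbb{R}^{n\times n}\text{ with } \operatorname{rank} M\le 2r .$$ Let $y=\mathcal{A}(M^\star)+\epsilon$, where $\epsilon_1,\dots,\epsilon_m$ are independent, mean-zero random variables, $\sigma\ge0$ is given by $\sigma^2=\frac1m\sum_{i=1}^m\mathbb{E}[\epsilon_i^2]$, and each $\epsilon_i$ is sub-Gaussian with parameter $K\sigma$, i.e. $\mathbb{E}\,e^{t\epsilon_i}\le e^{K^2\sigma^2t^2/2}$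 for all $t\in\mathbb{R}$. For every $K\ge0$ and every $c>0$ there is a constant $C>0$, depending only on $K$ and $c$, such that in every such situation and for every $\rho>0$ the following holds. If $$\delta\le\frac{\min\{1,\rho\}}{8\kappa\sqrt{r^\star}}\qquad\text{and}\qquad m\ge C\,\frac{1+\delta}{1-\delta}\cdot\frac{\sigma^2\,r\,n\log n}{\rho^2\lambda_{r^\star}(M^\star)^2},$$ then with probability at least $1-n^{-c}$ the set of minimizers $$\mathcal{P}_r\Big(\frac1m\sum_{i=1}^m y_iA_i\Big),\qquad \mathcal{P}_r(S)=\operatorname*{arg\,min}_{X\in\mathbb{R}^{n\times r}}\|XX^T-S\|_F,$$ is nonempty and every spectral initializer $X_0$ in it satisfies $$\frac1m\big\|\mathcal{A}(X_0X_0^T-M^\star)\big\|^2<\rho^2(1-\delta)\,\lambda_{r^\star}(M^\star)^2 .$$ -/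

import Mathlib

open MeasureTheory ProbabilityTheory

open scoped NNReal Matrix

attribute [local instance] Matrix.frobeniusNormedAddCommGroup

noncomputable section

namespace MatrixSensing

/-- The linear measurement operator `𝒜(M) = (⟨A₁, M⟩, …, ⟨Aₘ, M⟩) ∈ ℝᵐ`, where
`⟨A, M⟩ = tr(Aᵀ M)` is the Frobenius inner product. -/
def sensing {n m : ℕ} (A : Fin m → Matrix (Fin n) (Fin n) ℝ) (M : Matrix (Fin n) (Fin n) ℝ) :
    EuclideanSpace ℝ (Fin m) :=
  WithLp.toLp 2 fun i => ((A i)ᵀ * M).trace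

/-- Restricted isometry property with parameters `(k, δ)`: there is at least one measurement,
`0 ≤ δ < 1`, and `(1/m) ‖𝒜(M)‖²` is within a factor `1 ± δ` of `‖M‖_F²` for every matrix `M`
of rank at most `k`. Matrix norms are Frobenius norms. -/
structure RIP {n m : ℕ} (A : Fin m → Matrix (Fin n) (Fin n) ℝ) (k : ℕ) (δ : ℝ) : Prop where
  pos : 0 < m
  nonneg : 0 ≤ δ
  lt_one : δ < 1
  lower : ∀ M : Matrix (Fin n) (Fin n) ℝ, M.rank ≤ k →
    (1 - δ) * ‖M‖ ^ 2 ≤ (1 / (m : ℝ)) * ‖sensing A M‖ ^ 2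
  upper : ∀ M : Matrix (Fin n) (Fin n) ℝ, M.rank ≤ k →
    (1 / (m : ℝ)) * ‖sensing A M‖ ^ 2 ≤ (1 + δ) * ‖M‖ ^ 2

/-- `lam hM k` is the `k`-th largest eigenvalue of the symmetric matrix `M`, counted with
multiplicity, for `1 ≤ k ≤ n` (the value is not meaningful for other `k`). -/
def lam {n : ℕ} {M : Matrix (Fin n) (Fin n) ℝ} (hM : M.IsHermitian) (k : ℕ) : ℝ :=
  if h : k - 1 < Fintype.card (Fin n) then hM.eigenvalues₀ ⟨k - 1, h⟩ else 0

/-- The condition number `κ = λ₁(M) / λ_s(M)`. -/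
def condNum {n : ℕ} {M : Matrix (Fin n) (Fin n) ℝ} (hM : M.IsHermitian) (s : ℕ) : ℝ :=
  lam hM 1 / lam hM s

/-- The measurements `y = 𝒜(M) + ε`. -/
def measurements {n m : ℕ} (A : Fin m → Matrix (Fin n) (Fin n) ℝ) (M : Matrix (Fin n) (Fin n) ℝ)
    (ε : Fin m → ℝ) : EuclideanSpace ℝ (Fin m) :=
  sensing A M + WithLp.toLp 2 ε

/-- The matrix `(1/m) ∑ᵢ yᵢ Aᵢ`. -/
def backprojection {n m : ℕ} (A : Fin m → Matrix (Fin n) (Fin n) ℝ)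
    (y : EuclideanSpace ℝ (Fin m)) : Matrix (Fin n) (Fin n) ℝ :=
  (1 / (m : ℝ)) • ∑ i, y i • A i

/-- `𝒫_r(S) = argmin_{X ∈ ℝ^{n × r}} ‖X Xᵀ - S‖_F`, as the set of all global minimizers. -/
def lowRankArgmin {n : ℕ} (r : ℕ) (S : Matrix (Fin n) (Fin n) ℝ) :
    Set (Matrix (Fin n) (Fin r) ℝ) :=
  {X | ∀ Y : Matrix (Fin n) (Fin r) ℝ, ‖X * Xᵀ - S‖ ≤ ‖Y * Yᵀ - S‖}

/-- The spectral initializers, `𝒫_r((1/m) ∑ᵢ yᵢ Aᵢ)`, computed from the measurements `y`. -/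
def spectralInit {n m : ℕ} (r : ℕ) (A : Fin m → Matrix (Fin n) (Fin n) ℝ)
    (y : EuclideanSpace ℝ (Fin m)) : Set (Matrix (Fin n) (Fin r) ℝ) :=
  lowRankArgmin r (backprojection A y)

/-- The radius (basin) condition `(1/m) ‖𝒜(X Xᵀ - M)‖² < ρ² (1 - δ) λ_s(M)²`. -/
def RadiusCondition {n m r : ℕ} (A : Fin m → Matrix (Fin n) (Fin n) ℝ)
    {M : Matrix (Fin n) (Fin n) ℝ} (hM : M.IsHermitian) (s : ℕ) (δ ρ : ℝ)
    (X : Matrix (Fin n) (Fin r) ℝ) : Prop :=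
  (1 / (m : ℝ)) * ‖sensing A (X * Xᵀ - M)‖ ^ 2 < ρ ^ 2 * (1 - δ) * lam hM s ^ 2

end MatrixSensing

end

/-! Write `S = P + N`, with `P` the back-projection of `𝒜(M)` and `N` that of the noise, and put `D
= X * Xᵀ - M` for a minimizer `X`. Since `M` is itself of the form `Y * Yᵀ`, comparing `X` with `Y`
gives `‖D‖² ≤ 2⟨D, S - M⟩`; no spectral description of the minimizer is needed, and `S` need not be
symmetric. All combinations of `D` and `M` have rank at most `2r`, so the polarized RIP gives `⟨D, P
- M⟩ ≤ δ‖D‖‖M‖` (`RIP.frobInner_backprojection_sensing_le`), while trace duality gives `⟨D, N⟩ ≤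
√(2r)‖D‖‖N‖_op` (`frobInner_le_sqrt_rank_mul`). Dividing by `‖D‖` bounds the error, and the upper
RIP inequality for `D` turns this into the radius condition. For the noise, `uᵀ N v` is a weighted
sum of the `εᵢ` whose squared weights add up to at most `(1 + δ)/m` on the unit ball, by RIP for the
rank-one matrix `u vᵀ`. A sub-Gaussian tail and a union bound over at most `25 ^ n` pairs from a
`1/2`-net control `‖N‖_op`. -/

namespace MatrixSensing

/-! ### The Frobenius inner product -/

/-- The Frobenius inner product `⟨A, B⟩ = tr(Aᵀ B)` of real matrices. -/
noncomputable def frobInner {p q : ℕ} (A B : Matrix (Fin p) (Fin q) ℝ) : ℝ := (Aᵀ * B).trace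

section FrobInner

variable {p q : ℕ} (A B D : Matrix (Fin p) (Fin q) ℝ)

lemma frobInner_eq_sum : frobInner A B = ∑ i, ∑ j, A i j * B i j := by
  simp only [frobInner, Matrix.trace, Matrix.diag, Matrix.mul_apply, Matrix.transpose_apply]
  exact Finset.sum_comm

lemma frobInner_self : frobInner A A = ‖A‖ ^ 2 := by
  rw [Matrix.frobenius_norm_def, ← Real.sqrt_eq_rpow, Real.sq_sqrt (by positivity),
    frobInner_eq_sum]
  simp [sq]

lemma frobInner_comm : frobInner A B = frobInner B A := by
  simp [frobInner_eq_sum, mul_comm]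

lemma frobInner_add_right : frobInner A (B + D) = frobInner A B + frobInner A D := by
  simp [frobInner, Matrix.mul_add]

lemma frobInner_sub_right : frobInner A (B - D) = frobInner A B - frobInner A D := by
  simp [frobInner, Matrix.mul_sub]

lemma frobInner_smul_right (s : ℝ) : frobInner A (s • B) = s * frobInner A B := by
  simp [frobInner]

lemma frobInner_sum_right {ι : Type*} (s : Finset ι) (f : ι → Matrix (Fin p) (Fin q) ℝ) :
    frobInner A (∑ i ∈ s, f i) = ∑ i ∈ s, frobInner A (f i) := by
  simp [frobInner, Matrix.mul_sum, Matrix.trace_sum]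

lemma frobInner_add_left : frobInner (A + B) D = frobInner A D + frobInner B D := by
  rw [frobInner_comm, frobInner_add_right, frobInner_comm D, frobInner_comm D]

lemma frobInner_smul_left (s : ℝ) : frobInner (s • A) B = s * frobInner A B := by
  rw [frobInner_comm, frobInner_smul_right, frobInner_comm B]

lemma frobenius_norm_smul_add_smul_sq (s t : ℝ) :
    ‖s • A + t • B‖ ^ 2 = s ^ 2 * ‖A‖ ^ 2 + 2 * s * t * frobInner A B + t ^ 2 * ‖B‖ ^ 2 := by
  simp only [← frobInner_self, frobInner_add_left, frobInner_add_right, frobInner_smul_left,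
    frobInner_smul_right, frobInner_comm B A]
  ring

lemma frobenius_norm_sub_sq :
    ‖A - B‖ ^ 2 = ‖A‖ ^ 2 - 2 * frobInner A B + ‖B‖ ^ 2 := by
  have h := frobenius_norm_smul_add_smul_sq A B 1 (-1)
  simp only [one_smul, neg_smul, ← sub_eq_add_neg] at h
  rw [h]; ring

lemma frobInner_le_norm_mul_norm : frobInner A B ≤ ‖A‖ * ‖B‖ := by
  rcases eq_or_ne A 0 with rfl | hA
  · simp [frobInner]
  rcases eq_or_ne B 0 with rfl | hB
  · simp [frobInner]
  have ha := norm_pos_iff.2 hA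
  have hb := norm_pos_iff.2 hB
  have h := frobenius_norm_smul_add_smul_sq A B ‖B‖ (-‖A‖)
  have h0 : 0 ≤ ‖‖B‖ • A + (-‖A‖) • B‖ ^ 2 := sq_nonneg _
  have hab := mul_pos ha hb
  refine le_of_mul_le_mul_left (a := ‖A‖ * ‖B‖) ?_ hab
  nlinarith

lemma frobInner_vecMulVec (u : Fin p → ℝ) (v : Fin q → ℝ) :
    frobInner (Matrix.vecMulVec u v) B = u ⬝ᵥ B *ᵥ v := by
  simp only [frobInner_eq_sum, Matrix.vecMulVec_apply, dotProduct, Matrix.mulVec, Finset.mul_sum]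
  exact Finset.sum_congr rfl fun i _ => Finset.sum_congr rfl fun j _ => by ring

lemma frobenius_norm_vecMulVec_sq (u : EuclideanSpace ℝ (Fin p)) (v : EuclideanSpace ℝ (Fin q)) :
    ‖Matrix.vecMulVec u.ofLp v.ofLp‖ ^ 2 = ‖u‖ ^ 2 * ‖v‖ ^ 2 := by
  rw [← frobInner_self, frobInner_eq_sum, EuclideanSpace.real_norm_sq_eq,
    EuclideanSpace.real_norm_sq_eq, Finset.sum_mul_sum]
  simp only [Matrix.vecMulVec_apply]
  exact Finset.sum_congr rfl fun i _ => Finset.sum_congr rfl fun j _ => by ring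

end FrobInner

/-! ### Eigenvalues of symmetric matrices -/

section Spectral

variable {n : ℕ} {D : Matrix (Fin n) (Fin n) ℝ}

lemma eq_sum_smul_vecMulVec (hD : D.IsHermitian) :
    D = ∑ k, hD.eigenvalues k • Matrix.vecMulVec (hD.eigenvectorBasis k).ofLp
      (hD.eigenvectorBasis k).ofLp := by
  conv_lhs => rw [hD.spectral_theorem]
  ext i j
  rw [Unitary.conjStarAlgAut_apply, Matrix.mul_apply]
  simp only [Matrix.mul_diagonal, Matrix.star_apply, Matrix.sum_apply, Matrix.smul_apply,
    Matrix.vecMulVec_apply, Matrix.IsHermitian.eigenvectorUnitary_apply, Function.comp_apply,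
    smul_eq_mul, star_trivial, RCLike.ofReal_real_eq_id, id]
  exact Finset.sum_congr rfl fun k _ => by ring

lemma frobInner_eq_sum_eigenvalues (hD : D.IsHermitian) (N : Matrix (Fin n) (Fin n) ℝ) :
    frobInner D N = ∑ k, hD.eigenvalues k *
      ((hD.eigenvectorBasis k).ofLp ⬝ᵥ N *ᵥ (hD.eigenvectorBasis k).ofLp) := by
  conv_lhs => rw [eq_sum_smul_vecMulVec hD]
  rw [frobInner_comm, frobInner_sum_right]
  refine Finset.sum_congr rfl fun k _ => ?_
  rw [frobInner_comm, frobInner_smul_left, frobInner_vecMulVec]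

lemma norm_sq_eq_sum_eigenvalues_sq (hD : D.IsHermitian) :
    ‖D‖ ^ 2 = ∑ k, hD.eigenvalues k ^ 2 := by
  rw [← frobInner_self, frobInner_eq_sum_eigenvalues hD]
  refine Finset.sum_congr rfl fun k _ => ?_
  have h1 : ((hD.eigenvectorBasis k).ofLp ⬝ᵥ (hD.eigenvectorBasis k).ofLp) = 1 := by
    have h := EuclideanSpace.real_norm_sq_eq (hD.eigenvectorBasis k)
    rw [hD.eigenvectorBasis.norm_eq_one] at h
    simp only [dotProduct, ← sq]
    rw [← h]; norm_num
  rw [hD.mulVec_eigenvectorBasis, dotProduct_smul, h1, smul_eq_mul, mul_one, sq]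

lemma dotProduct_mulVec_le (N : Matrix (Fin n) (Fin n) ℝ) (u v : EuclideanSpace ℝ (Fin n)) :
    |u.ofLp ⬝ᵥ N *ᵥ v.ofLp| ≤ ‖Matrix.toEuclideanCLM (𝕜 := ℝ) N‖ * ‖u‖ * ‖v‖ := by
  have h : u.ofLp ⬝ᵥ N *ᵥ v.ofLp = inner ℝ u (Matrix.toEuclideanCLM (𝕜 := ℝ) N v) := by
    rw [EuclideanSpace.inner_eq_star_dotProduct, Matrix.ofLp_toEuclideanCLM, dotProduct_comm]
    simp
  rw [h]
  calc _ ≤ ‖u‖ * ‖Matrix.toEuclideanCLM (𝕜 := ℝ) N v‖ := abs_real_inner_le_norm _ _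
    _ ≤ ‖u‖ * (‖Matrix.toEuclideanCLM (𝕜 := ℝ) N‖ * ‖v‖) := by
      gcongr; exact ContinuousLinearMap.le_opNorm _ _
    _ = _ := by ring

open scoped Classical in
lemma rank_eq_card_filter (hD : D.IsHermitian) :
    D.rank = (Finset.univ.filter fun k => hD.eigenvalues k ≠ 0).card := by
  rw [hD.rank_eq_card_non_zero_eigs, Fintype.card_subtype]

/-- Duality between the nuclear and operator norms, for a symmetric matrix of bounded rank. -/
lemma frobInner_le_sqrt_rank_mul {k : ℕ} (hD : D.IsHermitian) (hk : D.rank ≤ k)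
    (N : Matrix (Fin n) (Fin n) ℝ) :
    frobInner D N ≤ Real.sqrt k * ‖D‖ * ‖Matrix.toEuclideanCLM (𝕜 := ℝ) N‖ := by
  classical
  set T := ‖Matrix.toEuclideanCLM (𝕜 := ℝ) N‖
  set s := Finset.univ.filter fun k => hD.eigenvalues k ≠ 0
  have hs : (s.card : ℝ) ≤ k := by
    exact_mod_cast (rank_eq_card_filter hD).symm.trans_le hk
  have h1 : frobInner D N ≤ (∑ j ∈ s, |hD.eigenvalues j|) * T := by
    rw [frobInner_eq_sum_eigenvalues hD, Finset.sum_mul, Finset.sum_filter]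
    refine Finset.sum_le_sum fun j _ => ?_
    split_ifs with h
    · refine (le_abs_self _).trans ?_
      rw [abs_mul]
      gcongr
      refine (dotProduct_mulVec_le N _ _).trans ?_
      rw [hD.eigenvectorBasis.norm_eq_one]; simp [T]
    · rw [not_not] at h; simp [h]
  have h2 : (∑ j ∈ s, |hD.eigenvalues j|) ≤ Real.sqrt k * ‖D‖ := by
    refine le_of_sq_le_sq ?_ (by positivity)
    rw [mul_pow, Real.sq_sqrt (by positivity), norm_sq_eq_sum_eigenvalues_sq hD]
    refine sq_sum_le_card_mul_sum_sq.trans ?_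
    simp only [sq_abs]
    have h3 : ∑ j ∈ s, hD.eigenvalues j ^ 2 ≤ ∑ j, hD.eigenvalues j ^ 2 :=
      Finset.sum_le_sum_of_subset_of_nonneg (Finset.subset_univ _) fun _ _ _ => sq_nonneg _
    exact mul_le_mul hs h3 (Finset.sum_nonneg fun _ _ => sq_nonneg _) (by positivity)
  exact h1.trans (mul_le_mul_of_nonneg_right h2 (norm_nonneg _))

lemma eigenvalues_le_lam_one (hD : D.IsHermitian) (i : Fin n) : hD.eigenvalues i ≤ lam hD 1 := by
  have h : 1 - 1 < Fintype.card (Fin n) := by simpa using i.pos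
  rw [lam, dif_pos h]
  exact hD.eigenvalues₀_antitone (Fin.le_def.2 (Nat.zero_le _))

lemma lam_rank_le_lam_one (hD : D.IsHermitian) (h1 : 1 ≤ D.rank) : lam hD D.rank ≤ lam hD 1 := by
  have hn : D.rank ≤ n := by simpa using D.rank_le_width
  have h : 1 - 1 < Fintype.card (Fin n) := by simp; omega
  have h' : D.rank - 1 < Fintype.card (Fin n) := by simp; omega
  rw [lam, dif_pos h', lam, dif_pos h]
  exact hD.eigenvalues₀_antitone (Fin.le_def.2 (Nat.zero_le _))

lemma lam_rank_pos (hD : D.PosSemidef) (h1 : 1 ≤ D.rank) :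
    0 < lam hD.isHermitian D.rank := by
  classical
  set hH := hD.isHermitian
  have hn : D.rank ≤ n := by simpa using D.rank_le_width
  have h' : D.rank - 1 < Fintype.card (Fin n) := by simp; omega
  rw [lam, dif_pos h']
  by_contra hneg
  rw [not_lt] at hneg
  -- The reindexing by which `eigenvalues` is defined from the sorted `eigenvalues₀`. From the first
  -- nonpositive sorted value onwards all eigenvalues vanish, leaving fewer than `D.rank` nonzero
  -- ones.
  let e : Fin (Fintype.card (Fin n)) ≃ Fin n := Fintype.equivOfCardEq (Fintype.card_fin _)
  have hsub : (Finset.univ.filter fun k => hH.eigenvalues k ≠ 0) ⊆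
      (Finset.Iio (⟨D.rank - 1, h'⟩ : Fin (Fintype.card (Fin n)))).map e.toEmbedding := by
    intro k hk
    rw [Finset.mem_filter] at hk
    rw [Finset.mem_map_equiv, Finset.mem_Iio]
    by_contra hlt
    rw [not_lt] at hlt
    exact hk.2 (le_antisymm ((hH.eigenvalues₀_antitone hlt).trans hneg) (hD.eigenvalues_nonneg k))
  have hc := Finset.card_le_card hsub
  rw [← rank_eq_card_filter hH, Finset.card_map, Fin.card_Iio] at hc
  simp only at hc
  omega

lemma norm_sq_le_rank_mul_lam_one_sq (hD : D.PosSemidef) :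
    ‖D‖ ^ 2 ≤ D.rank * lam hD.isHermitian 1 ^ 2 := by
  classical
  rw [norm_sq_eq_sum_eigenvalues_sq hD.isHermitian, rank_eq_card_filter hD.isHermitian,
    ← nsmul_eq_mul, ← Finset.sum_const, Finset.sum_filter]
  refine Finset.sum_le_sum fun j _ => ?_
  split_ifs with h
  · exact pow_le_pow_left₀ (hD.eigenvalues_nonneg j) (eigenvalues_le_lam_one _ j) 2
  · rw [not_not] at h; simp [h]

/-- The columns are `√λₖ vₖ` over the nonzero eigenvalues, padded with zero columns by the 0/1
matrix `P` of an embedding into `Fin r`. -/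
lemma exists_eq_mul_transpose {r : ℕ} (hD : D.PosSemidef) (hr : D.rank ≤ r) :
    ∃ Y : Matrix (Fin n) (Fin r) ℝ, D = Y * Yᵀ := by
  classical
  set hH := hD.isHermitian
  have hcard : Fintype.card {k // hH.eigenvalues k ≠ 0} ≤ Fintype.card (Fin r) := by
    rw [← hH.rank_eq_card_non_zero_eigs]; simpa using hr
  obtain ⟨e⟩ := Function.Embedding.nonempty_of_card_le hcard
  let Z : Matrix (Fin n) {k // hH.eigenvalues k ≠ 0} ℝ := Matrix.of fun i k =>
    Real.sqrt (hH.eigenvalues k) * hH.eigenvectorBasis k i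
  let P : Matrix {k // hH.eigenvalues k ≠ 0} (Fin r) ℝ :=
    Matrix.of fun k j => if e k = j then 1 else 0
  have hP : P * Pᵀ = 1 := by
    ext k l
    simp [P, Matrix.mul_apply, Matrix.one_apply, eq_comm]
  have hZ : D = Z * Zᵀ := by
    conv_lhs => rw [eq_sum_smul_vecMulVec hH]
    ext i j
    simp only [Matrix.sum_apply, Matrix.smul_apply, Matrix.vecMulVec_apply, smul_eq_mul,
      Matrix.mul_apply, Matrix.transpose_apply, Z, Matrix.of_apply]
    rw [← Finset.sum_filter_add_sum_filter_not Finset.univ fun k => hH.eigenvalues k ≠ 0,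
      Finset.sum_eq_zero (s := Finset.univ.filter fun k => ¬ hH.eigenvalues k ≠ 0)
        (fun k hk => by rw [not_not.1 (Finset.mem_filter.1 hk).2, zero_mul]), add_zero,
      Finset.sum_subtype (p := fun k => hH.eigenvalues k ≠ 0) _ (by simp)]
    refine Finset.sum_congr rfl fun k _ => ?_
    have h := Real.mul_self_sqrt (hD.eigenvalues_nonneg k.1)
    linear_combination -(hH.eigenvectorBasis k.1 i * hH.eigenvectorBasis k.1 j) * h
  refine ⟨Z * P, ?_⟩
  rw [Matrix.transpose_mul, Matrix.mul_assoc, ← Matrix.mul_assoc P, hP, Matrix.one_mul, ← hZ]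

end Spectral

/-! ### Nets and operator norms -/

/-- A `1/2`-net of the unit ball of cardinality at most `5 ^ dim`. -/
lemma exists_half_net_unit_ball (E : Type*) [NormedAddCommGroup E] [NormedSpace ℝ E]
    [FiniteDimensional ℝ E] :
    ∃ s : Finset E, s.card ≤ 5 ^ Module.finrank ℝ E ∧ (∀ x ∈ s, ‖x‖ ≤ 1) ∧
      ∀ x : E, ‖x‖ ≤ 1 → ∃ y ∈ s, ‖x - y‖ ≤ 1 / 2 := by
  classical
  -- A `1/2`-separated set of maximal cardinality is a net. Doubling it gives a `1`-separated set in
  -- the ball of radius `2`, where the bound `5 ^ dim` applies.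
  let P : ℕ → Prop := fun k => ∃ s : Finset E, s.card = k ∧ (∀ x ∈ s, ‖x‖ ≤ 1) ∧
    ∀ x ∈ s, ∀ y ∈ s, x ≠ y → 1 / 2 ≤ ‖x - y‖
  have hbound : ∀ s : Finset E, (∀ x ∈ s, ‖x‖ ≤ 1) →
      (∀ x ∈ s, ∀ y ∈ s, x ≠ y → 1 / 2 ≤ ‖x - y‖) → s.card ≤ 5 ^ Module.finrank ℝ E := by
    intro s h1 h2
    have hinj : Function.Injective fun x : E => (2 : ℝ) • x :=
      smul_right_injective E two_ne_zero
    rw [← Finset.card_image_of_injective s hinj]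
    apply Besicovitch.card_le_of_separated
    · intro c hc
      obtain ⟨x, hx, rfl⟩ := Finset.mem_image.1 hc
      rw [norm_smul, Real.norm_ofNat]
      linarith [h1 x hx]
    · intro c hc d hd hcd
      obtain ⟨x, hx, rfl⟩ := Finset.mem_image.1 hc
      obtain ⟨y, hy, rfl⟩ := Finset.mem_image.1 hd
      rw [← smul_sub, norm_smul, Real.norm_ofNat]
      linarith [h2 x hx y hy fun h => hcd (by rw [h])]
  have h0 : P 0 := ⟨∅, by simp⟩
  obtain ⟨s, hcard, h1, h2⟩ : P (Nat.findGreatest P (5 ^ Module.finrank ℝ E)) :=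
    Nat.findGreatest_spec (Nat.zero_le _) h0
  refine ⟨s, hbound s h1 h2, h1, fun x hx => ?_⟩
  by_contra! hfar
  have hxs : x ∉ s := fun h => by
    have := hfar x h
    simp at this
    linarith
  have h1' : ∀ y ∈ insert x s, ‖y‖ ≤ 1 := by
    intro y hy
    rcases Finset.mem_insert.1 hy with rfl | hy
    exacts [hx, h1 y hy]
  have h2' : ∀ y ∈ insert x s, ∀ z ∈ insert x s, y ≠ z → 1 / 2 ≤ ‖y - z‖ := by
    intro y hy z hz hyz
    rcases Finset.mem_insert.1 hy with rfl | hy'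
    · rcases Finset.mem_insert.1 hz with rfl | hz'
      exacts [absurd rfl hyz, (hfar z hz').le]
    · rcases Finset.mem_insert.1 hz with rfl | hz'
      · rw [norm_sub_rev]; exact (hfar y hy').le
      · exact h2 y hy' z hz' hyz
  have hle : (insert x s).card ≤ Nat.findGreatest P (5 ^ Module.finrank ℝ E) :=
    Nat.le_findGreatest (hbound _ h1' h2') ⟨_, rfl, h1', h2'⟩
  rw [Finset.card_insert_of_notMem hxs, hcard] at hle
  omega

lemma norm_le_two_mul_of_half_net {E : Type*} [NormedAddCommGroup E] [InnerProductSpace ℝ E]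
    {s : Set E} (hs : ∀ x : E, ‖x‖ ≤ 1 → ∃ y ∈ s, ‖x - y‖ ≤ 1 / 2) {z : E} {b : ℝ} (hb : 0 ≤ b)
    (h : ∀ y ∈ s, inner ℝ y z ≤ b) : ‖z‖ ≤ 2 * b := by
  rcases eq_or_ne z 0 with rfl | hz
  · simpa using hb
  have hz' := norm_pos_iff.2 hz
  obtain ⟨y, hy, hxy⟩ := hs (‖z‖⁻¹ • z) (by rw [norm_smul, norm_inv, norm_norm,
    inv_mul_cancel₀ hz'.ne'])
  have h1 : inner ℝ (‖z‖⁻¹ • z) z = ‖z‖ := by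
    rw [real_inner_smul_left, real_inner_self_eq_norm_sq]
    field_simp
  have h2 : inner ℝ (‖z‖⁻¹ • z - y) z ≤ 1 / 2 * ‖z‖ :=
    (real_inner_le_norm _ _).trans (by gcongr)
  rw [inner_sub_left, h1] at h2
  linarith [h y hy]

/-- Replacing each of the two unit vectors by a net point costs half of the norm, which is absorbed
on the left: a factor 2 for each. -/
lemma opNorm_le_four_mul_of_half_net {E : Type*} [NormedAddCommGroup E] [InnerProductSpace ℝ E]
    {s : Set E} (hs : ∀ x : E, ‖x‖ ≤ 1 → ∃ y ∈ s, ‖x - y‖ ≤ 1 / 2) (T : E →L[ℝ] E) {b : ℝ}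
    (hb : 0 ≤ b) (h : ∀ u ∈ s, ∀ v ∈ s, inner ℝ u (T v) ≤ b) : ‖T‖ ≤ 4 * b := by
  suffices hT : ‖T‖ ≤ 2 * b + ‖T‖ / 2 by linarith
  refine ContinuousLinearMap.opNorm_le_of_unit_norm (by positivity) fun x hx => ?_
  obtain ⟨y, hy, hxy⟩ := hs x hx.le
  have h1 : ‖T y‖ ≤ 2 * b := norm_le_two_mul_of_half_net hs hb fun u hu => h u hu y hy
  have h2 : ‖T (x - y)‖ ≤ ‖T‖ * (1 / 2) := T.le_opNorm_of_le hxy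
  have h3 : T x = T y + T (x - y) := by rw [← map_add]; congr 1; abel
  rw [h3]
  exact (norm_add_le _ _).trans (by linarith)

/-! ### Sub-Gaussian tails -/

lemma hasSubgaussianMGF_mono {Ω : Type*} [MeasurableSpace Ω] {μ : Measure Ω} {X : Ω → ℝ}
    {v w : ℝ≥0} (h : HasSubgaussianMGF X v μ) (hvw : v ≤ w) : HasSubgaussianMGF X w μ where
  integrable_exp_mul := h.integrable_exp_mul
  mgf_le t := (h.mgf_le t).trans (by gcongr)

lemma measure_le_sum_mul_le_exp {Ω : Type*} [MeasurableSpace Ω] {μ : Measure Ω}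
    [IsProbabilityMeasure μ] {ι : Type*} [Fintype ι] {X : ι → Ω → ℝ} {v : ℝ≥0}
    (hind : iIndepFun X μ) (hX : ∀ i, HasSubgaussianMGF (X i) v μ) (a : ι → ℝ) {b L : ℝ}
    (hb : 0 < b) (hL : 0 < L) (h : v * (∑ i, a i ^ 2) * (2 * L) ≤ b ^ 2) :
    μ {ω | b ≤ ∑ i, a i * X i ω} ≤ ENNReal.ofReal (Real.exp (-L)) := by
  have hind' : iIndepFun (fun i ω => a i * X i ω) μ :=
    hind.comp (fun i x => a i * x) fun i => measurable_const_mul _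
  have hmul : ∀ i, HasSubgaussianMGF (fun ω => a i * X i ω) (‖a i‖₊ ^ 2 * v) μ := fun i =>
    hasSubgaussianMGF_mono ((hX i).const_mul (a i)) <| le_of_eq <| by
      congr 1
      refine NNReal.eq ?_
      rw [NNReal.coe_pow, coe_nnnorm, Real.norm_eq_abs, sq_abs]
      rfl
  have hsum := HasSubgaussianMGF.sum_of_iIndepFun hind' (s := Finset.univ) fun i _ => hmul i
  -- Enlarging the variance proxy to `w` makes the Chernoff exponent exactly `-L` and avoids
  -- dividing by zero for degenerate noise.
  obtain ⟨w, hw⟩ : ∃ w : ℝ≥0, (w : ℝ) = b ^ 2 / (2 * L) := ⟨⟨b ^ 2 / (2 * L), by positivity⟩, rfl⟩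
  have hX' : HasSubgaussianMGF (fun ω => ∑ i, a i * X i ω) w μ := by
    refine hasSubgaussianMGF_mono hsum ?_
    rw [← NNReal.coe_le_coe, hw, le_div_iff₀ (by positivity)]
    simp only [NNReal.coe_sum, NNReal.coe_mul, NNReal.coe_pow, coe_nnnorm, Real.norm_eq_abs,
      sq_abs]
    rw [← Finset.sum_mul]
    linarith
  have htail := hX'.measure_ge_le hb.le
  have hexp : -b ^ 2 / (2 * (w : ℝ)) = -L := by
    rw [hw]
    field_simp
  rw [hexp] at htail
  rw [← ofReal_measureReal]
  exact ENNReal.ofReal_le_ofReal htail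

/-! ### Existence of spectral initializers -/

lemma lowRankArgmin_nonempty {n : ℕ} (r : ℕ) (S : Matrix (Fin n) (Fin n) ℝ) :
    (lowRankArgmin r S).Nonempty := by
  let _ : NormedSpace ℝ (Matrix (Fin n) (Fin r) ℝ) := Matrix.frobeniusNormedSpace
  have : ProperSpace (Matrix (Fin n) (Fin r) ℝ) := FiniteDimensional.proper ℝ _
  have hcont : Continuous fun X : Matrix (Fin n) (Fin r) ℝ => ‖X * Xᵀ - S‖ :=
    ((continuous_id.matrix_mul continuous_id.matrix_transpose).sub continuous_const).norm
  -- Coercivity comes from `‖X‖² = ⟨1, X * Xᵀ⟩ ≤ ‖1‖ ‖X * Xᵀ‖`; the `+ 1` keeps `c` positive when `n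
  -- = 0`.
  set c : ℝ := ‖(1 : Matrix (Fin n) (Fin n) ℝ)‖ + 1 with hc
  have hc0 : 0 < c := by positivity
  have hlow : ∀ X : Matrix (Fin n) (Fin r) ℝ, ‖X‖ ^ 2 / c + -‖S‖ ≤ ‖X * Xᵀ - S‖ := by
    intro X
    have h1 : ‖X‖ ^ 2 = frobInner 1 (X * Xᵀ) := by
      rw [← frobInner_self, frobInner, frobInner, Matrix.trace_mul_comm, Matrix.transpose_one,
        Matrix.one_mul]
    have h2 : ‖X‖ ^ 2 / c ≤ ‖X * Xᵀ‖ := by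
      rw [div_le_iff₀ hc0, h1]
      refine (frobInner_le_norm_mul_norm _ _).trans ?_
      rw [mul_comm]
      gcongr
      linarith
    linarith [norm_sub_norm_le (X * Xᵀ) S]
  have hlim : Filter.Tendsto (fun X : Matrix (Fin n) (Fin r) ℝ => ‖X * Xᵀ - S‖)
      (Filter.cocompact _) Filter.atTop := by
    refine Filter.tendsto_atTop_mono hlow (Filter.tendsto_atTop_add_const_right _ _ ?_)
    exact (((Filter.tendsto_pow_atTop two_ne_zero).comp
      (tendsto_norm_cocompact_atTop (E := Matrix (Fin n) (Fin r) ℝ)))).atTop_div_const hc0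
  obtain ⟨X, hX⟩ := hcont.exists_forall_le hlim
  exact ⟨X, hX⟩

/-! ### Deterministic error bound -/

section Deterministic

variable {n m : ℕ} {A : Fin m → Matrix (Fin n) (Fin n) ℝ}

lemma norm_sq_sensing (D : Matrix (Fin n) (Fin n) ℝ) :
    ‖sensing A D‖ ^ 2 = ∑ i, frobInner (A i) D ^ 2 :=
  EuclideanSpace.real_norm_sq_eq _

lemma frobInner_backprojection (D : Matrix (Fin n) (Fin n) ℝ) (y : EuclideanSpace ℝ (Fin m)) :
    frobInner D (backprojection A y) = 1 / (m : ℝ) * ∑ i, y i * frobInner (A i) D := by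
  rw [backprojection, frobInner_smul_right, frobInner_sum_right]
  simp only [frobInner_comm D, frobInner_smul_left]

lemma backprojection_add (y z : EuclideanSpace ℝ (Fin m)) :
    backprojection A (y + z) = backprojection A y + backprojection A z := by
  simp [backprojection, add_smul, Finset.sum_add_distrib]

lemma norm_sq_sensing_smul_add_smul (D M : Matrix (Fin n) (Fin n) ℝ) (s t : ℝ) :
    ‖sensing A (s • D + t • M)‖ ^ 2 = s ^ 2 * ‖sensing A D‖ ^ 2 +
      2 * s * t * ∑ i, frobInner (A i) M * frobInner (A i) D + t ^ 2 * ‖sensing A M‖ ^ 2 := by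
  simp only [norm_sq_sensing, frobInner_add_right, frobInner_smul_right, Finset.mul_sum,
    ← Finset.sum_add_distrib]
  exact Finset.sum_congr rfl fun i _ => by ring

lemma RIP.frobInner_backprojection_sensing_le {k : ℕ} {δ : ℝ} (h : RIP A k δ)
    {D M : Matrix (Fin n) (Fin n) ℝ} (hrank : ∀ s t : ℝ, (s • D + t • M).rank ≤ k) :
    frobInner D (backprojection A (sensing A M)) ≤ frobInner D M + δ * ‖D‖ * ‖M‖ := by
  rcases eq_or_ne D 0 with rfl | hD
  · simp [frobInner]
  rcases eq_or_ne M 0 with rfl | hM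
  · simp [frobInner, backprojection, sensing]
  have hd := norm_pos_iff.2 hD
  have hm := norm_pos_iff.2 hM
  -- Polarization: the weights give both summands the norm `‖D‖‖M‖`, so subtracting the two RIP
  -- bounds leaves only the cross terms and `δ‖D‖‖M‖`.
  have hu := h.upper _ (hrank ‖M‖ ‖D‖)
  have hl := h.lower _ (hrank ‖M‖ (-‖D‖))
  rw [norm_sq_sensing_smul_add_smul, frobenius_norm_smul_add_smul_sq] at hu hl
  rw [frobInner_backprojection]
  change 1 / (m : ℝ) * ∑ i, frobInner (A i) M * frobInner (A i) D ≤ _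
  set Q := ∑ i, frobInner (A i) M * frobInner (A i) D
  refine le_of_mul_le_mul_left (a := ‖D‖ * ‖M‖) ?_ (mul_pos hd hm)
  generalize 1 / (m : ℝ) = w at *
  linarith

lemma rank_smul_mul_transpose_add_le {r : ℕ} (X Y : Matrix (Fin n) (Fin r) ℝ) (s t : ℝ) :
    (s • (X * Xᵀ) + t • (Y * Yᵀ)).rank ≤ 2 * r := by
  have h : s • (X * Xᵀ) + t • (Y * Yᵀ) =
      Matrix.fromCols X Y * Matrix.fromRows (s • Xᵀ) (t • Yᵀ) := by
    rw [Matrix.fromCols_mul_fromRows, Matrix.mul_smul, Matrix.mul_smul]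
  rw [h]
  refine (Matrix.rank_mul_le_left _ _).trans ((Matrix.rank_le_card_width _).trans ?_)
  simp [two_mul]

lemma isHermitian_mul_transpose_sub {r : ℕ} {M : Matrix (Fin n) (Fin n) ℝ} (hM : M.IsHermitian)
    (X : Matrix (Fin n) (Fin r) ℝ) : (X * Xᵀ - M).IsHermitian := by
  refine Matrix.IsHermitian.sub ?_ hM
  simpa using Matrix.isHermitian_mul_conjTranspose_self X

lemma rank_mul_transpose_sub_le {r : ℕ} {M : Matrix (Fin n) (Fin n) ℝ} (hM : M.PosSemidef)
    (hr : M.rank ≤ r) (X : Matrix (Fin n) (Fin r) ℝ) : (X * Xᵀ - M).rank ≤ 2 * r := by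
  obtain ⟨Y, rfl⟩ := exists_eq_mul_transpose hM hr
  have h := rank_smul_mul_transpose_add_le X Y 1 (-1)
  rwa [one_smul, neg_one_smul, ← sub_eq_add_neg] at h

/-- Deterministic error bound for the spectral initializer. -/
lemma norm_sub_le_of_mem_spectralInit {r : ℕ} {δ : ℝ} (h : RIP A (2 * r) δ)
    {M : Matrix (Fin n) (Fin n) ℝ} (hM : M.PosSemidef) (hr : M.rank ≤ r) (e : Fin m → ℝ)
    {X : Matrix (Fin n) (Fin r) ℝ} (hX : X ∈ spectralInit r A (measurements A M e)) :
    ‖X * Xᵀ - M‖ ≤ 2 * δ * ‖M‖ + 2 * Real.sqrt (2 * r) *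
      ‖Matrix.toEuclideanCLM (𝕜 := ℝ) (backprojection A (WithLp.toLp 2 e))‖ := by
  set D := X * Xᵀ - M with hD
  set N := backprojection A (WithLp.toLp 2 e) with hN
  set P := backprojection A (sensing A M) with hP
  set T := ‖Matrix.toEuclideanCLM (𝕜 := ℝ) N‖
  obtain ⟨Y, hY⟩ := exists_eq_mul_transpose hM hr
  have hopt : ‖D - (P + N - M)‖ ≤ ‖P + N - M‖ := by
    have h1 := hX Y
    rw [← hY, measurements, backprojection_add, ← hP, ← hN, norm_sub_rev M] at h1
    rwa [hD, sub_sub_sub_cancel_right]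
  have hbasic : ‖D‖ ^ 2 ≤ 2 * (frobInner D P + frobInner D N - frobInner D M) := by
    have h2 := pow_le_pow_left₀ (norm_nonneg _) hopt 2
    rw [frobenius_norm_sub_sq, frobInner_sub_right, frobInner_add_right] at h2
    linarith
  have hrip : frobInner D P ≤ frobInner D M + δ * ‖D‖ * ‖M‖ := by
    refine h.frobInner_backprojection_sensing_le fun s t => ?_
    -- `s • D + t • M = s • (X * Xᵀ) + (t - s) • (Y * Yᵀ)`.
    have h3 := rank_smul_mul_transpose_add_le X Y s (t - s)
    rw [← hY] at h3
    convert h3 using 2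
    rw [hD]
    module
  have hnoise : frobInner D N ≤ Real.sqrt (2 * r) * ‖D‖ * T := by
    simpa using frobInner_le_sqrt_rank_mul (isHermitian_mul_transpose_sub hM.isHermitian X)
      (rank_mul_transpose_sub_le hM hr X) N
  rcases (norm_nonneg D).eq_or_lt with h0 | h0
  · rw [← h0]
    have := h.nonneg
    positivity
  · refine le_of_mul_le_mul_left (a := ‖D‖) ?_ h0
    linarith

/-- The radius condition holds as soon as the back-projected noise is small in operator norm. -/
lemma radiusCondition_of_opNorm_le {r : ℕ} {δ ρ : ℝ} (h : RIP A (2 * r) δ)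
    {M : Matrix (Fin n) (Fin n) ℝ} (hM : M.PosSemidef) (h1 : 1 ≤ M.rank) (hr : M.rank ≤ r)
    (hρ : 0 < ρ)
    (hδ : δ ≤ min 1 ρ / (8 * condNum hM.isHermitian M.rank * Real.sqrt M.rank)) (e : Fin m → ℝ)
    (hN : 2 * Real.sqrt (2 * r) *
      ‖Matrix.toEuclideanCLM (𝕜 := ℝ) (backprojection A (WithLp.toLp 2 e))‖ ≤
        ρ * lam hM.isHermitian M.rank / 2)
    {X : Matrix (Fin n) (Fin r) ℝ} (hX : X ∈ spectralInit r A (measurements A M e)) :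
    RadiusCondition A hM.isHermitian M.rank δ ρ X := by
  have hbound := norm_sub_le_of_mem_spectralInit h hM hr e hX
  have hl := lam_rank_pos hM h1
  have hl1 := lam_rank_le_lam_one hM.isHermitian h1
  set l := lam hM.isHermitian M.rank with hldef
  set l1 := lam hM.isHermitian 1 with hl1def
  set q := Real.sqrt M.rank with hq
  have hq1 : 1 ≤ q := Real.one_le_sqrt.2 (by exact_mod_cast h1)
  have hMnorm : ‖M‖ ≤ q * l1 := by
    refine le_of_sq_le_sq ?_ (by nlinarith)
    rw [mul_pow, hq, Real.sq_sqrt (by positivity)]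
    exact norm_sq_le_rank_mul_lam_one_sq hM
  have hκ : condNum hM.isHermitian M.rank = l1 / l := rfl
  have hl1pos : 0 < l1 := hl.trans_le hl1
  have hδ' : 8 * δ * (q * l1) ≤ min 1 ρ * l := by
    rw [hκ, le_div_iff₀ (by positivity)] at hδ
    have : δ * (8 * (l1 / l) * q) * l = 8 * δ * (q * l1) := by field_simp
    rw [← this]
    exact mul_le_mul_of_nonneg_right hδ hl.le
  -- Because `κ √r⋆ ≥ 1`.
  have hδ8 : δ ≤ 1 / 8 := by
    have h2 : l ≤ q * l1 := by nlinarith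
    have h3 : min 1 ρ * l ≤ l := mul_le_of_le_one_left hl.le (min_le_left _ _)
    have h4 : 8 * δ * l ≤ 8 * δ * (q * l1) :=
      mul_le_mul_of_nonneg_left h2 (by linarith [h.nonneg])
    nlinarith
  have hfirst : 2 * δ * ‖M‖ ≤ ρ * l / 4 := by
    have h2 : min 1 ρ * l ≤ ρ * l := mul_le_mul_of_nonneg_right (min_le_right _ _) hl.le
    have h3 : 2 * δ * ‖M‖ ≤ 2 * δ * (q * l1) :=
      mul_le_mul_of_nonneg_left hMnorm (by linarith [h.nonneg])
    linarith
  have hD : ‖X * Xᵀ - M‖ ≤ 3 / 4 * (ρ * l) := by linarith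
  have hD2 : ‖X * Xᵀ - M‖ ^ 2 ≤ (3 / 4 * (ρ * l)) ^ 2 := pow_le_pow_left₀ (norm_nonneg _) hD 2
  have hup := h.upper _ (rank_mul_transpose_sub_le hM hr X)
  have hpos : 0 < (ρ * l) ^ 2 := by positivity
  rw [RadiusCondition, ← hldef]
  have hup2 : (1 + δ) * ‖X * Xᵀ - M‖ ^ 2 ≤ (1 + δ) * (3 / 4 * (ρ * l)) ^ 2 :=
    mul_le_mul_of_nonneg_left hD2 (by linarith [h.nonneg])
  -- With `δ ≤ 1/8`, `(1 + δ) (3/4)² ≤ 81/128 < 7/8 ≤ 1 - δ`.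
  nlinarith

end Deterministic

/-! ### The noise -/

lemma measure_opNorm_backprojection_gt_le {n m k : ℕ} {A : Fin m → Matrix (Fin n) (Fin n) ℝ} {δ : ℝ}
    (h : RIP A k δ) (hk : 1 ≤ k) {Ω : Type*} [MeasurableSpace Ω] {μ : Measure Ω}
    [IsProbabilityMeasure μ] {ε : Fin m → Ω → ℝ} {v : ℝ≥0} (hind : iIndepFun ε μ)
    (hε : ∀ i, HasSubgaussianMGF (ε i) v μ) {b L : ℝ} (hb : 0 < b) (hL : 0 < L)
    (hbL : v * (1 + δ) * (2 * L) ≤ m * b ^ 2) :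
    μ {ω | 4 * b < ‖Matrix.toEuclideanCLM (𝕜 := ℝ)
      (backprojection A (WithLp.toLp 2 fun i => ε i ω))‖} ≤
      ENNReal.ofReal (25 ^ n * Real.exp (-L)) := by
  obtain ⟨s, hcard, hs1, hs⟩ := exists_half_net_unit_ball (EuclideanSpace ℝ (Fin n))
  rw [finrank_euclideanSpace_fin] at hcard
  have hm : (0 : ℝ) < m := by exact_mod_cast h.pos
  let a : EuclideanSpace ℝ (Fin n) × EuclideanSpace ℝ (Fin n) → Fin m → ℝ := fun p i =>
    1 / (m : ℝ) * frobInner (A i) (Matrix.vecMulVec p.1.ofLp p.2.ofLp)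
  have hsub : {ω | 4 * b < ‖Matrix.toEuclideanCLM (𝕜 := ℝ)
      (backprojection A (WithLp.toLp 2 fun i => ε i ω))‖} ⊆
      ⋃ p ∈ s ×ˢ s, {ω | b ≤ ∑ i, a p i * ε i ω} := by
    intro ω hω
    by_contra hn
    simp only [Set.mem_iUnion, Set.mem_ofPred_eq, exists_prop, not_exists, not_and, not_le] at hn
    refine not_le.2 hω (opNorm_le_four_mul_of_half_net (s := (s : Set _)) hs _ hb.le ?_)
    intro u hu v hv
    have h1 := hn (u, v) (Finset.mem_product.2 ⟨hu, hv⟩)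
    refine le_of_eq_of_le ?_ h1.le
    rw [EuclideanSpace.inner_eq_star_dotProduct, Matrix.ofLp_toEuclideanCLM, dotProduct_comm,
      star_trivial, ← frobInner_vecMulVec, frobInner_backprojection, Finset.mul_sum]
    exact Finset.sum_congr rfl fun i _ => by simp only [a]; ring
  have htail : ∀ p ∈ s ×ˢ s, μ {ω | b ≤ ∑ i, a p i * ε i ω} ≤ ENNReal.ofReal (Real.exp (-L)) := by
    intro p hp
    obtain ⟨hp1, hp2⟩ := Finset.mem_product.1 hp
    refine measure_le_sum_mul_le_exp hind hε (a p) hb hL ?_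
    have h2 := h.upper (Matrix.vecMulVec p.1.ofLp p.2.ofLp)
      ((Matrix.rank_vecMulVec_le _ _).trans hk)
    have h3 : ‖Matrix.vecMulVec p.1.ofLp p.2.ofLp‖ ^ 2 ≤ 1 := by
      rw [frobenius_norm_vecMulVec_sq]
      exact mul_le_one₀ (pow_le_one₀ (norm_nonneg _) (hs1 _ hp1)) (sq_nonneg _)
        (pow_le_one₀ (norm_nonneg _) (hs1 _ hp2))
    have h4 : ∑ i, a p i ^ 2 =
        1 / (m : ℝ) * (1 / (m : ℝ) * ‖sensing A (Matrix.vecMulVec p.1.ofLp p.2.ofLp)‖ ^ 2) := by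
      rw [norm_sq_sensing, Finset.mul_sum, Finset.mul_sum]
      exact Finset.sum_congr rfl fun i _ => by simp only [a]; ring
    have h5 : ∑ i, a p i ^ 2 ≤ 1 / (m : ℝ) * (1 + δ) := by
      rw [h4]
      gcongr
      exact h2.trans (mul_le_of_le_one_right (by linarith [h.nonneg]) h3)
    calc v * (∑ i, a p i ^ 2) * (2 * L) ≤ v * (1 / (m : ℝ) * (1 + δ)) * (2 * L) := by gcongr
      _ = 1 / (m : ℝ) * (v * (1 + δ) * (2 * L)) := by ring
      _ ≤ 1 / (m : ℝ) * (m * b ^ 2) := by gcongr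
      _ = b ^ 2 := by field_simp
  have hcard2 : ((s ×ˢ s).card : ℝ) ≤ 25 ^ n := by
    have h6 : (s ×ˢ s).card ≤ 25 ^ n := by
      rw [Finset.card_product]
      calc s.card * s.card ≤ 5 ^ n * 5 ^ n := Nat.mul_le_mul hcard hcard
        _ = 25 ^ n := by rw [← mul_pow]; norm_num
    exact_mod_cast h6
  calc _ ≤ μ (⋃ p ∈ s ×ˢ s, {ω | b ≤ ∑ i, a p i * ε i ω}) := measure_mono hsub
    _ ≤ ∑ p ∈ s ×ˢ s, μ {ω | b ≤ ∑ i, a p i * ε i ω} := measure_biUnion_finset_le _ _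
    _ ≤ ∑ p ∈ s ×ˢ s, ENNReal.ofReal (Real.exp (-L)) := Finset.sum_le_sum htail
    _ = ENNReal.ofReal ((s ×ˢ s).card * Real.exp (-L)) := by
      rw [Finset.sum_const, nsmul_eq_mul, ENNReal.ofReal_mul (by positivity),
        ENNReal.ofReal_natCast]
    _ ≤ _ := ENNReal.ofReal_le_ofReal (by gcongr)

end MatrixSensing

/-- The constant `C` hidden in the sample-size condition depends only on the exponent `c` of the
probability bound and on the ratio `K` between the sub-Gaussian parameter and the standard
deviation `σ` of the noise. The failure event is bounded in outer measure, so that no measurable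
selection of the minimizer is involved. -/
theorem proposition5 (K : ℝ≥0) (c : ℝ) (hc : 0 < c) :
    ∃ C : ℝ, 0 < C ∧
      ∀ (n m r rstar : ℕ) (A : Fin m → Matrix (Fin n) (Fin n) ℝ)
        (M : Matrix (Fin n) (Fin n) ℝ) (hM : M.PosSemidef)
        (δ ρ : ℝ) (σ : ℝ≥0)
        (Ω : Type*) (_ : MeasurableSpace Ω) (μ : Measure Ω) (_ : IsProbabilityMeasure μ)
        (ε : Fin m → Ω → ℝ),
        M.rank = rstar → 1 ≤ rstar → rstar ≤ r →
        MatrixSensing.RIP A (2 * r) δ →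
        (∀ i, Measurable (ε i)) →
        iIndepFun ε μ →
        (∀ i, HasSubgaussianMGF (ε i) ((K * σ) ^ 2) μ) →
        (∀ i, ∫ ω, ε i ω ∂μ = 0) →
        (σ : ℝ) ^ 2 = (1 / (m : ℝ)) * ∑ i, ∫ ω, ε i ω ^ 2 ∂μ →
        0 < ρ →
        δ ≤ min 1 ρ / (8 * MatrixSensing.condNum hM.isHermitian rstar * Real.sqrt rstar) →
        C * ((1 + δ) / (1 - δ)) *
            ((σ : ℝ) ^ 2 * r * n * Real.log n /
              (ρ ^ 2 * MatrixSensing.lam hM.isHermitian rstar ^ 2)) ≤ (m : ℝ) →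
        μ {ω | ¬ ((MatrixSensing.spectralInit r A
                    (MatrixSensing.measurements A M fun i => ε i ω)).Nonempty ∧
                  ∀ X₀ ∈ MatrixSensing.spectralInit r A
                    (MatrixSensing.measurements A M fun i => ε i ω),
                    MatrixSensing.RadiusCondition A hM.isHermitian rstar δ ρ X₀)}
          ≤ ENNReal.ofReal ((n : ℝ) ^ (-c)) := by

  -- `1024 = 2 * 512` comes from `2 * L` and `b² = ρ² l² / (512 r)`, and `5 + c` from `L ≤ (5 + c) n
  -- log n`; the `+ 1` ensures positivity when `K = 0`.
  refine ⟨1024 * K ^ 2 * (5 + c) + 1, by positivity, ?_⟩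
  intro n m r rstar A M hM δ ρ σ Ω _ μ _ ε hrank h1 hr hRIP _ hind hsub _ _ hρ hδ hm
  subst hrank
  have hn : 1 ≤ n := h1.trans (by simpa using M.rank_le_width)
  -- For `n = 1` the claimed bound is the trivial `1`; otherwise `log n ≥ log 2 > 0`.
  rcases hn.eq_or_lt with rfl | hn2
  · simpa using prob_le_one
  set l := MatrixSensing.lam hM.isHermitian M.rank with hl
  have hlpos : 0 < l := MatrixSensing.lam_rank_pos hM h1
  have hr0 : (0 : ℝ) < r := by exact_mod_cast h1.trans hr
  have hn0 : (0 : ℝ) < n := by exact_mod_cast hn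
  have hlog2 : Real.log 2 ≤ Real.log n :=
    Real.log_le_log (by norm_num) (by exact_mod_cast hn2)
  have hlogn : 0 < Real.log n := (Real.log_pos one_lt_two).trans_le hlog2
  have hlog25 : Real.log 25 ≤ 5 * Real.log 2 := by
    rw [← Real.log_rpow (by norm_num)]
    exact Real.log_le_log (by norm_num) (by norm_num)
  have hlog25' : 0 < Real.log 25 := Real.log_pos (by norm_num)
  set q := Real.sqrt (2 * r) with hq
  have hqpos : 0 < q := Real.sqrt_pos.2 (by positivity)
  have hq2 : q ^ 2 = 2 * r := Real.sq_sqrt (by positivity)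
  -- Chosen so that `2 * q * (4 * b) = ρ * l / 2`, the noise budget of the deterministic bound.
  set b := ρ * l / (16 * q) with hb
  have hbpos : 0 < b := by positivity
  -- The first term pays for the `25 ^ n` pairs of net points, the second leaves `n ^ (-c)`.
  set L := n * Real.log 25 + c * Real.log n with hL
  have hLpos : 0 < L := by positivity
  have hLle : L ≤ (5 + c) * (n * Real.log n) := by
    have h2 : (n : ℝ) * Real.log 25 ≤ n * (5 * Real.log n) := by gcongr; linarith
    have h3 : c * Real.log n ≤ c * (n * Real.log n) := by
      gcongr
      exact le_mul_of_one_le_left hlogn.le (by exact_mod_cast hn)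
    linarith
  have hδ0 := hRIP.nonneg
  have hδ1 := hRIP.lt_one
  have hbL : ((K * σ) ^ 2 : ℝ≥0) * (1 + δ) * (2 * L) ≤ m * b ^ 2 := by
    have hb2 : b ^ 2 = ρ ^ 2 * l ^ 2 / (512 * r) := by
      rw [hb, div_pow, mul_pow, mul_pow, hq2]; ring
    have h2 : 1 + δ ≤ (1 + δ) / (1 - δ) := by
      rw [le_div_iff₀ (by linarith)]
      nlinarith
    have h3 : (1024 * (K : ℝ) ^ 2 * (5 + c) + 1) * (1 + δ) *
        ((σ : ℝ) ^ 2 * r * n * Real.log n / (ρ ^ 2 * l ^ 2)) ≤ m := by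
      refine le_trans ?_ hm
      gcongr
    rw [hb2, mul_div_assoc', le_div_iff₀ (by positivity)]
    rw [mul_div_assoc', div_le_iff₀ (by positivity)] at h3
    push_cast
    calc ((K : ℝ) * σ) ^ 2 * (1 + δ) * (2 * L) * (512 * r)
        ≤ ((K : ℝ) * σ) ^ 2 * (1 + δ) * (2 * ((5 + c) * (n * Real.log n))) * (512 * r) := by
          gcongr
      _ = (1024 * (K : ℝ) ^ 2 * (5 + c)) * (1 + δ) * ((σ : ℝ) ^ 2 * r * n * Real.log n) := by
          ring
      _ ≤ (1024 * (K : ℝ) ^ 2 * (5 + c) + 1) * (1 + δ) *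
            ((σ : ℝ) ^ 2 * r * n * Real.log n) := by
          gcongr
          linarith
      _ ≤ m * (ρ ^ 2 * l ^ 2) := h3
  have hprob := MatrixSensing.measure_opNorm_backprojection_gt_le hRIP (by omega) hind hsub hbpos hLpos hbL
  have hexp : 25 ^ n * Real.exp (-L) = (n : ℝ) ^ (-c) := by
    rw [hL, neg_add, Real.exp_add, Real.rpow_def_of_pos hn0, ← mul_assoc,
      ← Real.rpow_natCast, Real.rpow_def_of_pos (by norm_num : (0 : ℝ) < 25), ← Real.exp_add,
      ← Real.exp_add]
    congr 1
    ring
  rw [hexp] at hprob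
  refine (measure_mono ?_).trans hprob
  intro ω hω
  by_contra hsmall
  rw [Set.mem_ofPred_eq, not_lt] at hsmall
  refine hω ⟨MatrixSensing.lowRankArgmin_nonempty _ _, fun X hX => ?_⟩
  refine MatrixSensing.radiusCondition_of_opNorm_le hRIP hM h1 hr hρ hδ _ ?_ hX
  calc 2 * q * _ ≤ 2 * q * (4 * b) := by gcongr
    _ = ρ * l / 2 := by rw [hb]; field_simp; norm_num
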